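/- **Setting.** Let $N$ be a finite set of agents and $A$ a finite set of indivisible items. Each agent $i\in N$ has a valuation $\mathcal V_i:2^A\to\mathbb R$ with $\mathcal V_i(\emptyset)=0$; it is monotone if $S'\subseteq S$ implies $\mathcal V_i(S')\le \mathcal V_i(S)$. An item $a$ is relevant for agent $i$ if $\mathcal V_i(S\setminus\{a\})<\mathcal V_i(S)$ for some $S\subseteq A$. An allocation $\pi=(\pi_i)_{i\in N}$ is a partition of $A$ into (possibly empty) bundles $\pi_i$, one for each agent. It is an orientation if every $\pi_i$ contains only items relevant for $i$. It is EFXr (envy-free up to any relevant item) if $\mathcal V_i(\pi_i)\ge \mathcal V_i(\pi_j\setminus\{a\})$ for all $i,j\in N$ and every $a\in\pi_j$ that is relevant for $i$. **Theorem.** Let $G$ be a finite simple graph, not necessarily connected, embedded in the plane, such that every inner (bounded) face is a triangle. The agents are the vertices of $G$, the items are the inner faces of $G$, all valuations are monotone, and every inner face is relevant for exactly its three vertices. Then an EFXr orientation of the inner faces exists. Moreover, it can be found in polynomial time: there is one algorithm that, given the embedded graph (as a combinatorial embedding, i.e. the half-edges with their origins, twins, successors along the facial walks and incident faces, an incident face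 for each vertex, and the outer face), outputs within a number of steps polynomial in the size of this description an allocation that is an EFXr orientation for every such family of valuations. (Steps are counted on a random access machine with addition and subtraction at unit cost; the algorithm does not query the valuations.) -/

import Mathlib

/-! ### Fair division of indivisible items -/

namespace FairDivision

variable {N A : Type*} [DecidableEq N] [Fintype A] [DecidableEq A]

/-- A monotone valuation: the empty bundle has value `0`, and values grow with the bundle. -/
def IsMonotoneValuation (v : Finset A → ℝ) : Prop :=
  v ∅ = 0 ∧ ∀ S T : Finset A, S ⊆ T → v S ≤ v T

/-- An item is relevant for an agent with valuation `v` if removing it from some set of items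
lowers the value of that set. -/
def Relevant (v : Finset A → ℝ) (a : A) : Prop :=
  ∃ S : Finset A, v (S \ {a}) < v S

/-- An allocation (an ordered partition of all items into bundles) is given by the function that
sends an item to the agent who receives it; `bundle π i` is the bundle of agent `i`. -/
def bundle (π : A → N) (i : N) : Finset A :=
  Finset.univ.filter fun a => π a = i

/-- Every agent receives only items that are relevant for that agent. -/
def IsOrientation (V : N → Finset A → ℝ) (π : A → N) : Prop :=
  ∀ i : N, ∀ a ∈ bundle π i, Relevant (V i) a

/-- Envy-freeness up to any relevant item. -/
def IsEFXr (V : N → Finset A → ℝ) (π : A → N) : Prop :=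
  ∀ i j : N, ∀ a ∈ bundle π j, Relevant (V i) a →
    V i (bundle π j \ {a}) ≤ V i (bundle π i)

end FairDivision

/-! ### Embedded planar graphs -/

/-- A finite simple graph with the combinatorial data of an embedding, as a half-edge structure.
Every edge consists of two oppositely directed darts, exchanged by `twin`; `origin d` is the
vertex at which `d` starts; `next d` is the dart that follows `d` on the facial walk to the left
of `d`; `face d` is the face to the left of `d`.  The rotation at a vertex is
`d ↦ next (twin d)`.  The graph may be disconnected, so a face may be bounded by several facial
walks and may contain isolated vertices: `vertexFace v` is a face whose boundary contains `v`
(the only such face if `v` is isolated, and one of the faces around `v` otherwise). -/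
structure EmbeddedGraph where
  numVertices : ℕ
  numDarts : ℕ
  numFaces : ℕ
  origin : Fin numDarts → Fin numVertices
  twin : Fin numDarts → Fin numDarts
  next : Equiv.Perm (Fin numDarts)
  face : Fin numDarts → Fin numFaces
  vertexFace : Fin numVertices → Fin numFaces
  outer : Fin numFaces
  twin_twin : ∀ d, twin (twin d) = d
  /-- no loops (in particular `twin` has no fixed point) -/
  no_loop : ∀ d, origin (twin d) ≠ origin d
  /-- no parallel edges -/
  no_parallel : ∀ d e, origin d = origin e → origin (twin d) = origin (twin e) → d = e
  origin_next : ∀ d, origin (next d) = origin (twin d)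
  /-- the darts that start at a vertex form one cycle of the rotation -/
  rotation : ∀ d e, origin d = origin e → ∃ m : ℕ, (fun x => next (twin x))^[m] d = e
  face_next : ∀ d, face (next d) = face d
  vertexFace_eq : ∀ d, ∃ e, origin e = origin d ∧ face e = vertexFace (origin d)

namespace EmbeddedGraph

variable (M : EmbeddedGraph)

/-- The underlying simple graph. -/
def graph : SimpleGraph (Fin M.numVertices) where
  Adj u v := ∃ d, M.origin d = u ∧ M.origin (M.twin d) = v
  symm := ⟨fun u v ⟨d, hu, hv⟩ => ⟨M.twin d, hv, by rw [M.twin_twin]; exact hu⟩⟩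
  loopless := ⟨fun _ ⟨d, hu, hv⟩ => M.no_loop d (hv.trans hu.symm)⟩

/-- The vertex `v` lies on the boundary of the face `g`. -/
def Incident (v : Fin M.numVertices) (g : Fin M.numFaces) : Prop :=
  M.vertexFace v = g ∨ ∃ d, M.origin d = v ∧ M.face d = g

/-- The number of boundary components: facial walks (cycles of `next`) and isolated vertices. -/
noncomputable def numBoundaryComponents : ℕ :=
  Nat.card (Quotient (Equiv.Perm.SameCycle.setoid M.next)) +
    Nat.card {v : Fin M.numVertices // ∀ d, M.origin d ≠ v}

/-- The incidence graph between the connected components of the graph and the faces. -/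
def incidenceGraph : SimpleGraph (M.graph.ConnectedComponent ⊕ Fin M.numFaces) :=
  SimpleGraph.fromRel fun x y =>
    ∃ v g, M.Incident v g ∧ x = Sum.inl (M.graph.connectedComponentMk v) ∧ y = Sum.inr g

/-- The embedding is an embedding in the plane.  Every boundary component joins one component of
the graph to one face; in the plane these joints form a tree (connected, with one joint less than
there are nodes), which says how the components are placed in each other's faces.  Given this,
Euler's formula `V + F = E + C + 1` says that every component is embedded with genus zero. -/
structure IsPlane : Prop where
  connected : M.incidenceGraph.Connected
  tree : M.numBoundaryComponents + 1 = Nat.card M.graph.ConnectedComponent + M.numFaces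
  euler : M.numVertices + M.numFaces =
    Nat.card M.graph.edgeSet + Nat.card M.graph.ConnectedComponent + 1

/-- The face `g` is a triangle: its boundary is a single facial walk of length three.  (As there
are no loops, the three vertices are distinct.) -/
def IsTriangle (g : Fin M.numFaces) : Prop :=
  ∃ d, M.next (M.next (M.next d)) = d ∧
    (∀ e, M.face e = g ↔ e = d ∨ e = M.next d ∨ e = M.next (M.next d)) ∧
    ∀ v, M.Incident v g →
      v = M.origin d ∨ v = M.origin (M.next d) ∨ v = M.origin (M.next (M.next d))

/-- The inner faces; these are the items. -/
abbrev InnerFace : Type := {g : Fin M.numFaces // g ≠ M.outer}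

/-- All inner faces are triangles. -/
def InnerTriangulated : Prop := ∀ g : M.InnerFace, M.IsTriangle g.1

/-- `V` is a profile of monotone valuations of the vertices over the inner faces for which every
inner face is relevant exactly for the vertices on its boundary. -/
def IsFaceInstance (V : Fin M.numVertices → Finset M.InnerFace → ℝ) : Prop :=
  (∀ v, FairDivision.IsMonotoneValuation (V v)) ∧
    ∀ (v : Fin M.numVertices) (g : M.InnerFace),
      FairDivision.Relevant (V v) g ↔ M.Incident v g.1

/-- The description of an embedded graph as a list of numbers. -/
def encode : List ℕ :=
  [M.numVertices, M.numDarts, M.numFaces, M.outer.1] ++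
    (List.ofFn fun d => (M.origin d).1) ++
    (List.ofFn fun d => (M.twin d).1) ++
    (List.ofFn fun d => (M.next d).1) ++
    (List.ofFn fun d => (M.face d).1) ++
    (List.ofFn fun v => (M.vertexFace v).1)

/-- The description of an allocation of the inner faces as a list of numbers: the entry at an
inner face is the vertex that receives it, and the entry at the outer face is `0`. -/
def encodeAllocation (π : M.InnerFace → Fin M.numVertices) : List ℕ :=
  List.ofFn fun g => if h : g = M.outer then 0 else (π ⟨g, h⟩).1

end EmbeddedGraph

/-! ### Random access machines and polynomial time -/

namespace RAM

/-- A state: registers, and memory cells that can be addressed indirectly. -/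
structure State where
  reg : ℕ → ℕ
  mem : ℕ → ℕ

/-- Programs.  The arguments are numbers of registers, except for the constant in `const`.  There
is no multiplication, so that unit cost is polynomially equivalent to Turing machine time. -/
inductive Program : Type
  | const (x c : ℕ) : Program
  | add (x y z : ℕ) : Program
  | sub (x y z : ℕ) : Program
  | load (x y : ℕ) : Program
  | store (x y : ℕ) : Program
  | seq (P Q : Program) : Program
  | ifZero (x : ℕ) (P Q : Program) : Program
  | whileNonzero (x : ℕ) (P : Program) : Program

/-- The state after assigning the value `c` to register `x`. -/
def State.setReg (s : State) (x c : ℕ) : State :=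
  ⟨Function.update s.reg x c, s.mem⟩

/-- The state after writing the value `c` into memory cell `i`. -/
def State.setMem (s : State) (i c : ℕ) : State :=
  ⟨s.reg, Function.update s.mem i c⟩

/-- `Exec P s t s'`: started in state `s`, the program `P` halts in state `s'` after exactly `t`
steps.  Every instruction and every test of a register costs one step. -/
inductive Exec : Program → State → ℕ → State → Prop
  | const (x c : ℕ) (s : State) : Exec (.const x c) s 1 (s.setReg x c)
  | add (x y z : ℕ) (s : State) : Exec (.add x y z) s 1 (s.setReg x (s.reg y + s.reg z))
  | sub (x y z : ℕ) (s : State) : Exec (.sub x y z) s 1 (s.setReg x (s.reg y - s.reg z))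
  | load (x y : ℕ) (s : State) : Exec (.load x y) s 1 (s.setReg x (s.mem (s.reg y)))
  | store (x y : ℕ) (s : State) : Exec (.store x y) s 1 (s.setMem (s.reg x) (s.reg y))
  | seq {P Q : Program} {s s' s'' : State} {t t' : ℕ} :
      Exec P s t s' → Exec Q s' t' s'' → Exec (.seq P Q) s (t + t') s''
  | ifZero_true {x : ℕ} {P Q : Program} {s s' : State} {t : ℕ} :
      s.reg x = 0 → Exec P s t s' → Exec (.ifZero x P Q) s (t + 1) s'
  | ifZero_false {x : ℕ} {P Q : Program} {s s' : State} {t : ℕ} :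
      s.reg x ≠ 0 → Exec Q s t s' → Exec (.ifZero x P Q) s (t + 1) s'
  | while_done {x : ℕ} {P : Program} {s : State} :
      s.reg x = 0 → Exec (.whileNonzero x P) s 1 s
  | while_step {x : ℕ} {P : Program} {s s' s'' : State} {t t' : ℕ} :
      s.reg x ≠ 0 → Exec P s t s' → Exec (.whileNonzero x P) s' t' s'' →
        Exec (.whileNonzero x P) s (t + t' + 1) s''

/-- The initial state: the input in the first memory cells, and `0` everywhere else. -/
def initialState (input : List ℕ) : State :=
  ⟨fun _ => 0, fun i => input.getD i 0⟩

/-- A search problem is solvable in polynomial time: one program halts on every input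
`a` that satisfies the promise, within a number of steps polynomial in the length of the input,
and has then written, into the cells right after the input, a list that `IsSolution a` accepts. -/
def SolvableInPolyTime {α : Type*} (encode : α → List ℕ) (Promise : α → Prop)
    (IsSolution : α → List ℕ → Prop) : Prop :=
  ∃ (P : Program) (p : Polynomial ℕ), ∀ a : α, Promise a →
    ∃ (t : ℕ) (s : State) (output : List ℕ),
      Exec P (initialState (encode a)) t s ∧ t ≤ p.eval (encode a).length ∧
      (∀ (i : ℕ) (hi : i < output.length), s.mem ((encode a).length + i) = output[i]) ∧
      IsSolution a output

end RAM

/-! It suffices to give faces that share an edge to different vertices. Suppose `a` lies in the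
bundle of `j` and is relevant for `i ≠ j`. Then `a` contains the edge `ij`. Any other item of that
bundle relevant for `i` also contains this edge. In a simple graph it would lie on the other side of
the edge, so two adjacent faces would both belong to `j`. Hence all that remains without `a` is
irrelevant for `i` and has value `0` (`IsFaceInstance.isOrientation_isEFXr`).

Such an assignment is a list colouring of the dual graph in which each inner face has a list of
three vertices. Every face can be reached from the outer face by crossing edges
(`IsPlane.forall_of_closed`). In the reverse order of such an exploration, each face is treated
while the face it was entered from is still unassigned or is the outer face. At most two
neighbouring values must then be avoided, and one of three vertices is free
(`IsAssignmentOutside.uncons`).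

The algorithm runs this argument with two loops, and existence is read off its halting run. -/

namespace FairDivision

/-- Deleting an irrelevant item never lowers the value, so the items can be removed one by one down
to the empty bundle. -/
theorem IsMonotoneValuation.eq_zero_of_forall_not_relevant {A : Type*} [DecidableEq A]
    {v : Finset A → ℝ}
    (hv : IsMonotoneValuation v) (S : Finset A) (hS : ∀ a ∈ S, ¬ Relevant v a) : v S = 0 := by
  induction S using Finset.induction_on with
  | empty => exact hv.1
  | insert a S ha ih =>
    have h0 : v S = 0 := ih fun b hb => hS b (Finset.mem_insert_of_mem hb)
    have h1 : v (insert a S) ≤ v S := by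
      by_contra! h
      refine hS a (Finset.mem_insert_self a S) ⟨insert a S, ?_⟩
      rwa [Finset.insert_sdiff_of_mem _ (Finset.mem_singleton_self a),
        Finset.sdiff_singleton_eq_erase, Finset.erase_eq_of_notMem ha]
    exact le_antisymm (h0 ▸ h1) (h0 ▸ hv.2 _ _ (Finset.subset_insert a S))

theorem IsMonotoneValuation.nonneg {A : Type*} {v : Finset A → ℝ} (hv : IsMonotoneValuation v)
    (S : Finset A) : 0 ≤ v S :=
  hv.1 ▸ hv.2 _ _ (Finset.empty_subset S)

end FairDivision

namespace EmbeddedGraph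

variable {M : EmbeddedGraph}

/-! ### Triangles -/

/-- The three darts of a triangle, starting from any one of them. -/
theorem IsTriangle.darts {g : Fin M.numFaces} (hg : M.IsTriangle g) {d : Fin M.numDarts}
    (hd : M.face d = g) :
    M.next (M.next (M.next d)) = d ∧
      (∀ e, M.face e = g → e = d ∨ e = M.next d ∨ e = M.next (M.next d)) ∧
      ∀ v, M.Incident v g →
        v = M.origin d ∨ v = M.origin (M.next d) ∨ v = M.origin (M.next (M.next d)) := by
  obtain ⟨c, hc, hf, hv⟩ := hg
  rcases (hf d).1 hd with rfl | rfl | rfl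
  · exact ⟨hc, fun e he => (hf e).1 he, hv⟩
  · simp only [hc]
    exact ⟨trivial, fun e he => by have := (hf e).1 he; tauto, fun v h => by have := hv v h; tauto⟩
  · simp only [hc]
    exact ⟨trivial, fun e he => by have := (hf e).1 he; tauto, fun v h => by have := hv v h; tauto⟩

theorem origin_next_ne (d : Fin M.numDarts) : M.origin (M.next d) ≠ M.origin d := by
  rw [M.origin_next]; exact M.no_loop d

/-- If a facial walk of length three used both darts of an edge, its remaining dart would be a loop.
-/
theorem IsTriangle.face_twin_ne {g : Fin M.numFaces} (hg : M.IsTriangle g) {d : Fin M.numDarts}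
    (hd : M.face d = g) : M.face (M.twin d) ≠ g := by
  intro h
  obtain ⟨hc, hf, -⟩ := hg.darts hd
  rcases hf _ h with h | h | h
  · exact M.no_loop d (by rw [h])
  · have h1 : M.origin (M.next (M.next d)) = M.origin d := by
      rw [M.origin_next (M.next d), ← h, M.twin_twin]
    have := origin_next_ne (M.next (M.next d))
    rw [hc] at this
    exact this h1.symm
  · have := origin_next_ne (M.next d)
    rw [← h, ← M.origin_next d] at this
    exact this rfl

/-- Two vertices of a triangle are joined by one of its darts. -/
theorem IsTriangle.exists_dart {g : Fin M.numFaces} (hg : M.IsTriangle g)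
    {u v : Fin M.numVertices} (hu : M.Incident u g) (hv : M.Incident v g) (huv : u ≠ v) :
    ∃ d, M.face d = g ∧ (M.origin d = u ∧ M.origin (M.twin d) = v ∨
      M.origin d = v ∧ M.origin (M.twin d) = u) := by
  obtain ⟨d, hc, hf, hi⟩ := hg
  have h0 : M.face d = g := (hf d).2 (Or.inl rfl)
  have h1 : M.face (M.next d) = g := by rw [M.face_next, h0]
  have h2 : M.face (M.next (M.next d)) = g := by rw [M.face_next, h1]
  have e0 := M.origin_next d
  have e1 := M.origin_next (M.next d)
  have e2 := M.origin_next (M.next (M.next d))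
  rw [hc] at e2
  rcases hi u hu with rfl | rfl | rfl <;> rcases hi v hv with rfl | rfl | rfl
  · exact absurd rfl huv
  · exact ⟨d, h0, Or.inl ⟨rfl, e0.symm⟩⟩
  · exact ⟨_, h2, Or.inr ⟨rfl, e2.symm⟩⟩
  · exact ⟨d, h0, Or.inr ⟨rfl, e0.symm⟩⟩
  · exact absurd rfl huv
  · exact ⟨_, h1, Or.inl ⟨rfl, e1.symm⟩⟩
  · exact ⟨_, h2, Or.inl ⟨rfl, e2.symm⟩⟩
  · exact ⟨_, h1, Or.inr ⟨rfl, e1.symm⟩⟩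
  · exact absurd rfl huv

/-! ### A sufficient condition for EFXr orientations -/

/-- An orientation that gives adjacent inner faces to different vertices is EFXr. -/
theorem IsFaceInstance.isOrientation_isEFXr {V : Fin M.numVertices → Finset M.InnerFace → ℝ}
    (hV : M.IsFaceInstance V) (hT : M.InnerTriangulated) {π : M.InnerFace → Fin M.numVertices}
    (hinc : ∀ g, M.Incident (π g) g.1)
    (hadj : ∀ (d : Fin M.numDarts) (g h : M.InnerFace), M.face d = g.1 →
      M.face (M.twin d) = h.1 → π g ≠ π h) :
    FairDivision.IsOrientation V π ∧ FairDivision.IsEFXr V π := by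
  refine ⟨fun i a ha => ?_, fun i j a ha hr => ?_⟩
  · rw [hV.2]
    simp only [FairDivision.bundle, Finset.mem_filter, Finset.mem_univ, true_and] at ha
    exact ha ▸ hinc a
  by_cases hij : i = j
  · subst hij
    exact (hV.1 i).2 _ _ Finset.sdiff_subset
  -- The bundle of `j` without `a` turns out to contain nothing relevant for `i`.
  rw [(hV.1 i).eq_zero_of_forall_not_relevant]
  · exact (hV.1 i).nonneg _
  intro b hb hrb
  simp only [FairDivision.bundle, Finset.mem_filter, Finset.mem_univ, true_and, Finset.mem_sdiff,
    Finset.mem_singleton] at ha hb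
  obtain ⟨hbj, hba⟩ := hb
  rw [hV.2] at hr hrb
  obtain ⟨d, hd, hd'⟩ := (hT a).exists_dart hr (ha ▸ hinc a) hij
  obtain ⟨e, he, he'⟩ := (hT b).exists_dart hrb (hbj ▸ hinc b) hij
  -- Both darts join `i` and `j`, and there is only one such edge.
  have key : d = e ∨ M.twin d = e := by
    rcases hd' with ⟨h1, h2⟩ | ⟨h1, h2⟩ <;> rcases he' with ⟨h3, h4⟩ | ⟨h3, h4⟩
    · exact Or.inl (M.no_parallel _ _ (h1.trans h3.symm) (h2.trans h4.symm))
    · exact Or.inr (M.no_parallel _ _ (h2.trans h3.symm)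
        (by rw [M.twin_twin]; exact h1.trans h4.symm))
    · exact Or.inr (M.no_parallel _ _ (h2.trans h3.symm)
        (by rw [M.twin_twin]; exact h1.trans h4.symm))
    · exact Or.inl (M.no_parallel _ _ (h1.trans h3.symm) (h2.trans h4.symm))
  rcases key with rfl | rfl
  · exact hba (Subtype.ext (he.symm.trans hd))
  · exact hadj d a b hd he (ha.trans hbj.symm)

/-! ### Exploring the faces from the outer face -/

/-- A set of faces that is closed under crossing edges contains all faces around the vertices
of a connected component as soon as it contains one. -/
theorem forall_incident_of_reachable {S : Fin M.numFaces → Prop}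
    (hS : ∀ d, S (M.face (M.twin d)) → S (M.face d)) {u v : Fin M.numVertices}
    (huv : M.graph.Reachable u v) {g : Fin M.numFaces} (hu : M.Incident u g) (hg : S g) :
    ∀ h, M.Incident v h → S h := by
  have twin (d) (hd : S (M.face d)) : S (M.face (M.twin d)) :=
    hS _ (by rwa [M.twin_twin])
  -- One rotation step crosses an edge by `twin` and then stays in the same face by `next`.
  have around (d e) (hde : M.origin d = M.origin e) (hd : S (M.face d)) : S (M.face e) := by
    obtain ⟨m, rfl⟩ := M.rotation d e hde
    clear hde
    induction m with
    | zero => exact hd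
    | succ m ih =>
      rw [Function.iterate_succ_apply', M.face_next]
      exact twin _ ih
  have star (d) (hd : S (M.face d)) (h) (hh : M.Incident (M.origin d) h) : S h := by
    rcases hh with rfl | ⟨e, he, rfl⟩
    · obtain ⟨e, he, he'⟩ := M.vertexFace_eq d
      rw [← he']
      exact around d e he.symm hd
    · exact around d e he.symm hd
  obtain ⟨w⟩ := huv
  induction w generalizing g with
  | nil =>
    rename_i u
    by_cases hi : ∃ d, M.origin d = u
    · obtain ⟨d, rfl⟩ := hi
      refine star d ?_
      rcases hu with rfl | ⟨e, he, rfl⟩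
      · obtain ⟨e, he, he'⟩ := M.vertexFace_eq d
        exact around e d he (he' ▸ hg)
      · exact around e d he hg
    -- An isolated vertex is incident with a single face.
    · intro h hh
      have h1 : M.vertexFace u = g := hu.resolve_right fun ⟨d, hd, _⟩ => hi ⟨d, hd⟩
      have h2 : M.vertexFace u = h := hh.resolve_right fun ⟨d, hd, _⟩ => hi ⟨d, hd⟩
      rwa [← h2, h1]
  | cons hadj _ ih =>
    obtain ⟨d, rfl, rfl⟩ := hadj
    have hd : S (M.face d) := by
      rcases hu with rfl | ⟨e, he, rfl⟩
      · obtain ⟨e, he, he'⟩ := M.vertexFace_eq d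
        exact around e d he (he' ▸ hg)
      · exact around e d he hg
    exact ih (Or.inr ⟨_, rfl, rfl⟩) (twin d hd)

/-- In a plane graph, a set of faces that contains the outer face and is closed under crossing
edges contains every face. -/
theorem IsPlane.forall_of_closed (hM : M.IsPlane) {S : Fin M.numFaces → Prop}
    (h0 : S M.outer) (hS : ∀ d, S (M.face (M.twin d)) → S (M.face d)) (g : Fin M.numFaces) :
    S g := by
  -- The property is extended to components so that it can be carried along walks in the incidence
  -- graph, which also link different components.
  let P : M.graph.ConnectedComponent ⊕ Fin M.numFaces → Prop :=
    Sum.elim (fun C => ∀ v h, M.graph.connectedComponentMk v = C → M.Incident v h → S h) S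
  have step : ∀ x y, M.incidenceGraph.Adj x y → P x → P y := by
    rintro x y ⟨-, ⟨v, g, hi, rfl, rfl⟩ | ⟨v, g, hi, rfl, rfl⟩⟩ hx
    · exact hx v g rfl hi
    · intro w h hw
      exact forall_incident_of_reachable hS (SimpleGraph.ConnectedComponent.exact hw.symm) hi hx h
  have walk : ∀ x y, M.incidenceGraph.Walk x y → P x → P y := by
    intro x y w
    induction w with
    | nil => exact id
    | cons h _ ih => exact fun hx => ih (step _ _ h hx)
  obtain ⟨w⟩ := hM.connected.preconnected (Sum.inr M.outer) (Sum.inr g)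
  exact walk _ _ w h0

variable (M) in
/-- The faces reached by an exploration: the outer face and those to the left of the darts. -/
def Reached (l : List (Fin M.numDarts)) (g : Fin M.numFaces) : Prop :=
  g = M.outer ∨ ∃ d ∈ l, M.face d = g

variable (M) in
/-- A list of darts that records an exploration of the faces, the last step first: each dart is
one across which a new face was entered from a face reached before. -/
inductive IsExploration : List (Fin M.numDarts) → Prop
  | nil : IsExploration []
  | cons {d l} : IsExploration l → ¬ M.Reached l (M.face d) → M.Reached l (M.face (M.twin d)) →
      IsExploration (d :: l)

theorem reached_cons {d : Fin M.numDarts} {l : List (Fin M.numDarts)} {g : Fin M.numFaces} :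
    M.Reached (d :: l) g ↔ g = M.face d ∨ M.Reached l g := by
  simp only [Reached, List.mem_cons, exists_eq_or_imp, eq_comm (a := M.face d)]
  tauto

/-- A recorded dart has its face reached, so it cannot enter that face again. This bounds the length
of the list. -/
theorem IsExploration.nodup {l : List (Fin M.numDarts)} (hl : M.IsExploration l) : l.Nodup := by
  induction hl with
  | nil => exact List.nodup_nil
  | cons _ h _ ih => exact List.nodup_cons.2 ⟨fun hd => h (Or.inr ⟨_, hd, rfl⟩), ih⟩

theorem IsExploration.length_le {l : List (Fin M.numDarts)} (hl : M.IsExploration l) :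
    l.length ≤ M.numDarts := by
  simpa using hl.nodup.length_le_card

theorem IsExploration.isTriangle {d : Fin M.numDarts} {l : List (Fin M.numDarts)}
    (hl : M.IsExploration (d :: l)) (hT : M.InnerTriangulated) : M.IsTriangle (M.face d) := by
  cases hl with
  | cons _ hd _ => exact hT ⟨M.face d, fun h => hd (Or.inl h)⟩

/-! ### Greedy assignment in the reverse order of exploration. -/

variable (M) in
/-- The values `c` assign the faces outside of the exploration `l` to vertices on their
boundary, adjacent ones to different vertices. -/
def IsAssignmentOutside (l : List (Fin M.numDarts)) (c : Fin M.numFaces → ℕ) : Prop :=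
  (∀ g, ¬ M.Reached l g → ∃ v : Fin M.numVertices, c g = v ∧ M.Incident v g) ∧
    ∀ d, ¬ M.Reached l (M.face d) → ¬ M.Reached l (M.face (M.twin d)) →
      c (M.face d) ≠ c (M.face (M.twin d))

/-- Undoing the last step of an exploration, one assigns the face to a vertex that its two other
neighbours do not have. -/
theorem IsAssignmentOutside.uncons (hT : M.InnerTriangulated) {d : Fin M.numDarts}
    {l : List (Fin M.numDarts)} (hl : M.IsExploration (d :: l)) {c : Fin M.numFaces → ℕ}
    (hc : M.IsAssignmentOutside (d :: l) c) {v : Fin M.numVertices}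
    (hv : M.Incident v (M.face d)) (h1 : (v : ℕ) ≠ c (M.face (M.twin (M.next d))))
    (h2 : (v : ℕ) ≠ c (M.face (M.twin (M.next (M.next d))))) :
    M.IsAssignmentOutside l (Function.update c (M.face d) v) := by
  have htri := hl.isTriangle hT
  cases hl with
  | cons hl hd ht =>
  have old {g} (hg : ¬ M.Reached l g) (hgd : g ≠ M.face d) : ¬ M.Reached (d :: l) g := by
    rw [reached_cons]; tauto
  -- Across `d` itself lies a face reached earlier, which imposes no condition yet; only the two
  -- other edges matter.
  have avoid (e) (he : M.face e = M.face d) (het : ¬ M.Reached l (M.face (M.twin e))) :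
      (v : ℕ) ≠ c (M.face (M.twin e)) := by
    rcases (htri.darts rfl).2.1 e he with rfl | rfl | rfl
    · exact absurd ht het
    · exact h1
    · exact h2
  refine ⟨fun g hg => ?_, fun e he het => ?_⟩
  · by_cases hgd : g = M.face d
    · subst hgd
      exact ⟨v, by simp, hv⟩
    · rw [Function.update_of_ne hgd]
      exact hc.1 g (old hg hgd)
  · by_cases h : M.face e = M.face d
    · have h' : M.face (M.twin e) ≠ M.face d := htri.face_twin_ne h
      rw [Function.update_of_ne h', h, Function.update_self]
      exact avoid e h het
    rw [Function.update_of_ne h]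
    by_cases h' : M.face (M.twin e) = M.face d
    · rw [h', Function.update_self]
      have := avoid (M.twin e) h' (by rwa [M.twin_twin])
      rw [M.twin_twin] at this
      exact this.symm
    · rw [Function.update_of_ne h']
      exact hc.2 e (old he h) (old het h')

/-- A complete assignment is an EFXr orientation. -/
theorem IsAssignmentOutside.exists_orientation (hT : M.InnerTriangulated) {c : Fin M.numFaces → ℕ}
    (hc : M.IsAssignmentOutside [] c) :
    ∃ π : M.InnerFace → Fin M.numVertices, (∀ g, c g.1 = π g) ∧
      ∀ V : Fin M.numVertices → Finset M.InnerFace → ℝ, M.IsFaceInstance V →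
        FairDivision.IsOrientation V π ∧ FairDivision.IsEFXr V π := by
  have inner (g : M.InnerFace) : ¬ M.Reached [] g.1 := by simp [Reached, g.2]
  choose π hπ hinc using fun g : M.InnerFace => hc.1 g.1 (inner g)
  refine ⟨π, hπ, fun V hV => hV.isOrientation_isEFXr hT hinc fun d g h hg hh e => ?_⟩
  refine hc.2 d (hg ▸ inner g) (hh ▸ inner h) ?_
  rw [hg, hh, hπ, hπ, e]

end EmbeddedGraph

/-! ### Semantics and running time of programs. -/

namespace RAM

@[simp] theorem State.setReg_reg (s : State) (x c y : ℕ) :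
    (s.setReg x c).reg y = if y = x then c else s.reg y := by
  simp [State.setReg, Function.update_apply]

@[simp] theorem State.setReg_mem (s : State) (x c : ℕ) : (s.setReg x c).mem = s.mem := rfl

@[simp] theorem State.setMem_reg (s : State) (i c : ℕ) : (s.setMem i c).reg = s.reg := rfl

@[simp] theorem State.setMem_mem (s : State) (i c j : ℕ) :
    (s.setMem i c).mem j = if j = i then c else s.mem j := by
  simp [State.setMem, Function.update_apply]

namespace Program

/-- The effect of a program without loops. -/
def run : Program → State → State
  | const x c, s => s.setReg x c
  | add x y z, s => s.setReg x (s.reg y + s.reg z)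
  | sub x y z, s => s.setReg x (s.reg y - s.reg z)
  | load x y, s => s.setReg x (s.mem (s.reg y))
  | store x y, s => s.setMem (s.reg x) (s.reg y)
  | seq P Q, s => Q.run (P.run s)
  | ifZero x P Q, s => if s.reg x = 0 then P.run s else Q.run s
  | whileNonzero _ _, s => s

/-- The program has no loops. -/
def LoopFree : Program → Prop
  | seq P Q => P.LoopFree ∧ Q.LoopFree
  | ifZero _ P Q => P.LoopFree ∧ Q.LoopFree
  | whileNonzero _ _ => False
  | _ => True

/-- The number of instructions and tests. -/
def size : Program → ℕ
  | seq P Q => P.size + Q.size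
  | ifZero _ P Q => P.size + Q.size + 1
  | whileNonzero _ P => P.size + 1
  | _ => 1

/-- The program changes no register below `k`. -/
def Fixes (k : ℕ) : Program → Prop
  | const x _ => k ≤ x
  | add x _ _ => k ≤ x
  | sub x _ _ => k ≤ x
  | load x _ => k ≤ x
  | store _ _ => True
  | seq P Q => P.Fixes k ∧ Q.Fixes k
  | ifZero _ P Q => P.Fixes k ∧ Q.Fixes k
  | whileNonzero _ P => P.Fixes k

theorem LoopFree.exists_exec {P : Program} (hP : P.LoopFree) (s : State) :
    ∃ t ≤ P.size, Exec P s t (P.run s) := by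
  induction P generalizing s with
  | const x c => exact ⟨1, le_rfl, .const ..⟩
  | add x y z => exact ⟨1, le_rfl, .add ..⟩
  | sub x y z => exact ⟨1, le_rfl, .sub ..⟩
  | load x y => exact ⟨1, le_rfl, .load ..⟩
  | store x y => exact ⟨1, le_rfl, .store ..⟩
  | seq P Q ihP ihQ =>
    obtain ⟨t, ht, h⟩ := ihP hP.1 s
    obtain ⟨t', ht', h'⟩ := ihQ hP.2 (P.run s)
    exact ⟨t + t', add_le_add ht ht', h.seq h'⟩
  | ifZero x P Q ihP ihQ =>
    simp only [run, size]
    split_ifs with hx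
    · obtain ⟨t, ht, h⟩ := ihP hP.1 s
      exact ⟨t + 1, by omega, .ifZero_true hx h⟩
    · obtain ⟨t, ht, h⟩ := ihQ hP.2 s
      exact ⟨t + 1, by omega, .ifZero_false hx h⟩
  | whileNonzero x P => exact hP.elim

theorem Fixes.run_reg {k : ℕ} {P : Program} (hP : P.Fixes k) (s : State) {x : ℕ} (hx : x < k) :
    (P.run s).reg x = s.reg x := by
  induction P generalizing s with
  | seq P Q ihP ihQ => rw [run, ihQ hP.2, ihP hP.1]
  | ifZero y P Q ihP ihQ =>
    rw [run]
    split_ifs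
    · exact ihP hP.1 s
    · exact ihQ hP.2 s
  | store x y => rfl
  | whileNonzero x P => rfl
  | _ => exact (State.setReg_reg ..).trans (if_neg (by simp only [Fixes] at hP; omega))

/-- The rule for loops: the index of the invariant decreases with every pass. -/
theorem LoopFree.exists_exec_while {P : Program} (hP : P.LoopFree) (x : ℕ)
    {I : ℕ → State → Prop}
    (hI : ∀ n s, I n s → s.reg x ≠ 0 → ∃ m < n, I m (P.run s)) (n : ℕ) (s : State) (hs : I n s) :
    ∃ t ≤ n * (P.size + 1) + 1, ∃ s' m, Exec (.whileNonzero x P) s t s' ∧ I m s' ∧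
      s'.reg x = 0 := by
  induction n using Nat.strong_induction_on generalizing s with
  | _ n ih =>
  by_cases hx : s.reg x = 0
  · exact ⟨1, by omega, s, n, .while_done hx, hs, hx⟩
  obtain ⟨m, hm, h⟩ := hI n s hs hx
  obtain ⟨t, ht, s', m', he, hs', hx'⟩ := ih m hm _ h
  obtain ⟨t₀, ht₀, he₀⟩ := hP.exists_exec s
  refine ⟨t₀ + t + 1, ?_, s', m', .while_step hx he₀ he, hs', hx'⟩
  -- One unit of the index pays for one pass of the body and its test.
  have : (m + 1) * (P.size + 1) ≤ n * (P.size + 1) := Nat.mul_le_mul_right _ hm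
  rw [add_mul] at this
  omega

/-- Read entry `y` of the array that starts at `b`. -/
def fetch (x b y : ℕ) : Program := seq (add x b y) (load x x)

@[simp] theorem run_fetch (x b y : ℕ) (s : State) :
    (fetch x b y).run s = s.setReg x (s.mem (s.reg b + s.reg y)) := by
  simp only [fetch, run, State.setReg_reg, State.setReg_mem, if_true]
  simp [State.setReg]

/-- Run `P` if the registers `x` and `y` agree and `Q` otherwise; the register `z` is scratch. -/
def ifEq (z x y : ℕ) (P Q : Program) : Program :=
  seq (sub z x y) (seq (sub (z + 1) y x) (seq (add z z (z + 1)) (ifZero z P Q)))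

end Program

end RAM

/-! ### The algorithm as a program. -/

namespace RAM

namespace Program

/-- Subtraction is truncated, so the two differences add up to `0` only for equal values. The first
write must not destroy `x` or `y`, which the second subtraction still reads. -/
theorem run_ifEq {z x y : ℕ} (hx : x ≠ z) (hy : y ≠ z)
    (P Q : Program) (s : State) :
    (ifEq z x y P Q).run s =
      let s' := (((s.setReg z (s.reg x - s.reg y)).setReg (z + 1) (s.reg y - s.reg x)).setReg z
        (s.reg x - s.reg y + (s.reg y - s.reg x)))
      if s.reg x = s.reg y then P.run s' else Q.run s' := by
  have h : s.reg x - s.reg y + (s.reg y - s.reg x) = 0 ↔ s.reg x = s.reg y := by omega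
  simp [ifEq, run, hx, hy, -Nat.add_eq_zero_iff, h]

/-- Put into register `22` one of the values of the registers `17`, `18`, `19`, different from
those of the registers `14` and `16`; register `2` holds `0`. -/
def choose : Program :=
  let other := ifEq 20 18 14 (add 22 19 2) (ifEq 20 18 16 (add 22 19 2) (add 22 18 2))
  ifEq 20 17 14 other (ifEq 20 17 16 other (add 22 17 2))

theorem run_choose_mem (s : State) : (choose.run s).mem = s.mem := by
  simp only [choose, run_ifEq, ne_eq, Nat.reduceEqDiff, Nat.reduceAdd,
    not_false_eq_true, run]
  split_ifs <;> rfl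

/-- Two forbidden values cannot exclude three distinct candidates. -/
theorem run_choose_reg (s : State) (h2 : s.reg 2 = 0) (h₁ : s.reg 17 ≠ s.reg 18)
    (h₂ : s.reg 17 ≠ s.reg 19) (h₃ : s.reg 18 ≠ s.reg 19) :
    (choose.run s).reg 22 ≠ s.reg 14 ∧ (choose.run s).reg 22 ≠ s.reg 16 ∧
      ((choose.run s).reg 22 = s.reg 17 ∨ (choose.run s).reg 22 = s.reg 18 ∨
        (choose.run s).reg 22 = s.reg 19) := by
  simp only [choose, run_ifEq, ne_eq, Nat.reduceEqDiff, Nat.reduceAdd, not_false_eq_true, run,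
    State.setReg_reg, if_false, h2]
  split_ifs <;> simp only [State.setReg_reg, Nat.reduceEqDiff, if_false, if_true] <;> omega

/-- Load the layout of the input: register `0` holds `1`, register `1` the number of darts,
register `2` holds `0`, register `3` the outer face, and the registers `4` to `9` the starts of
`origin`, `twin`, `next`, `face`, the output, and the list of darts of the exploration.  Then
mark the outer face, and let register `10` be the end of the list, and register `11` the next
dart. -/
def setup : Program :=
  seq (load 8 0) <| seq (const 0 1) <| seq (load 1 0) <| seq (const 2 2) <| seq (load 2 2) <|
  seq (const 3 3) <| seq (load 3 3) <| seq (const 4 4) <| seq (add 5 4 1) <| seq (add 6 5 1) <|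
  seq (add 7 6 1) <| seq (add 9 7 1) <| seq (add 8 9 8) <| seq (add 9 8 2) <| seq (const 2 0) <|
  seq (add 10 9 2) <| seq (add 11 1 2) <| seq (add 12 8 3) (store 12 0)

/-- If the face of the next dart is not marked and the face of its twin is, then mark the face,
append the dart to the list, and start again with the last dart. -/
def explore : Program :=
  seq (sub 11 11 0) <| seq (fetch 12 7 11) <| seq (add 12 8 12) <| seq (load 13 12) <|
  ifZero 13
    (seq (fetch 14 5 11) <| seq (fetch 14 7 14) <| seq (fetch 14 8 14) <|
      ifZero 14 (const 13 0)
        (seq (store 12 0) <| seq (store 10 11) <| seq (add 10 10 0) (add 11 1 2)))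
    (const 13 0)

/-- Read the last dart of the list, the values of the two neighbouring faces, and the three
vertices. -/
def inspect : Program :=
  seq (sub 15 15 0) <| seq (fetch 11 9 15) <| seq (fetch 12 6 11) <| seq (fetch 13 6 12) <|
  seq (fetch 14 5 12) <| seq (fetch 14 7 14) <| seq (fetch 14 8 14) <|
  seq (fetch 16 5 13) <| seq (fetch 16 7 16) <| seq (fetch 16 8 16) <|
  seq (fetch 17 4 11) <| seq (fetch 18 4 12) (fetch 19 4 13)

/-- Assign the face of the last dart of the list, and remove the dart. -/
def assign : Program :=
  seq inspect <| seq choose <| seq (fetch 12 7 11) <| seq (add 12 8 12) (store 12 22)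

/-- The algorithm. -/
def orient : Program :=
  seq setup <| seq (whileNonzero 11 explore) <| seq (sub 15 10 9) <|
    seq (whileNonzero 15 assign) <| seq (add 12 8 3) (store 12 2)

theorem loopFree_setup : setup.LoopFree := by simp [setup, LoopFree]

theorem loopFree_explore : explore.LoopFree := by simp [explore, fetch, LoopFree]

theorem loopFree_assign : assign.LoopFree := by
  simp [assign, inspect, choose, ifEq, fetch, LoopFree]

theorem fixes_explore : explore.Fixes 10 := by simp [explore, fetch, Fixes]

theorem fixes_inspect : inspect.Fixes 10 := by simp [inspect, fetch, Fixes]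

theorem fixes_choose : choose.Fixes 20 := by simp [choose, ifEq, Fixes]

theorem fixes_assign : assign.Fixes 10 := by
  simp [assign, inspect, choose, ifEq, fetch, Fixes]

end Program

/-- The cells from `b` on contain the entries of the list, the last one first. -/
def Stores {n : ℕ} (mem : ℕ → ℕ) (b : ℕ) : List (Fin n) → Prop
  | [] => True
  | d :: l => mem (b + l.length) = d ∧ Stores mem b l

theorem Stores.congr {n : ℕ} {mem mem' : ℕ → ℕ} {b : ℕ} {l : List (Fin n)}
    (hl : Stores mem b l) (h : ∀ i < l.length, mem' (b + i) = mem (b + i)) :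
    Stores mem' b l := by
  induction l with
  | nil => trivial
  | cons d l ih =>
    exact ⟨(h _ (by simp)).trans hl.1, ih hl.2 fun i hi => h i (hi.trans (by simp))⟩

end RAM

/-! ### Memory layout and correctness of the algorithm. -/

namespace EmbeddedGraph

open RAM

variable {M : EmbeddedGraph}

variable (M) in
theorem length_encode : M.encode.length =
    4 + M.numDarts + M.numDarts + M.numDarts + M.numDarts + M.numVertices := by
  simp [encode]; ring

variable (M) in
/-- The registers `0` to `9` contain the layout of the input, and the input is unchanged. -/
structure IsLoaded (s : State) : Prop where
  one : s.reg 0 = 1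
  numDarts : s.reg 1 = M.numDarts
  zero : s.reg 2 = 0
  outer : s.reg 3 = M.outer
  origin : s.reg 4 = 4
  twin : s.reg 5 = 4 + M.numDarts
  next : s.reg 6 = 4 + M.numDarts + M.numDarts
  face : s.reg 7 = 4 + M.numDarts + M.numDarts + M.numDarts
  output : s.reg 8 = M.encode.length
  darts : s.reg 9 = M.encode.length + M.numFaces
  input : ∀ i < M.encode.length, s.mem i = M.encode.getD i 0

namespace IsLoaded

theorem congr {s s' : State} (hs : M.IsLoaded s) (hr : ∀ x < 10, s'.reg x = s.reg x)
    (hm : ∀ i < M.encode.length, s'.mem i = s.mem i) : M.IsLoaded s' := by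
  constructor
  case input => exact fun i hi => (hm i hi).trans (hs.input i hi)
  all_goals rw [hr _ (by norm_num)]
  exacts [hs.one, hs.numDarts, hs.zero, hs.outer, hs.origin, hs.twin, hs.next, hs.face, hs.output,
    hs.darts]

theorem mem_origin {s : State} (hs : M.IsLoaded s) (d : Fin M.numDarts) :
    s.mem (s.reg 4 + d) = M.origin d := by
  have := d.2
  rw [hs.origin, hs.input _ (by rw [length_encode]; omega)]
  simp only [encode, List.append_assoc]
  rw [List.getD_append_right _ _ _ _ (by simp), List.getD_append _ _ _ _ (by simp)]
  simp [List.getD_eq_getElem?_getD]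

theorem mem_twin {s : State} (hs : M.IsLoaded s) (d : Fin M.numDarts) :
    s.mem (s.reg 5 + d) = M.twin d := by
  have := d.2
  rw [hs.twin, hs.input _ (by rw [length_encode]; omega)]
  simp only [encode, List.append_assoc]
  rw [List.getD_append_right _ _ _ _ (by simp; omega),
    List.getD_append_right _ _ _ _ (by simp; omega), List.getD_append _ _ _ _ (by simp; omega)]
  simp [List.getD_eq_getElem?_getD, Nat.add_assoc]

theorem mem_next {s : State} (hs : M.IsLoaded s) (d : Fin M.numDarts) :
    s.mem (s.reg 6 + d) = M.next d := by
  have := d.2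
  rw [hs.next, hs.input _ (by rw [length_encode]; omega)]
  simp only [encode, List.append_assoc]
  rw [List.getD_append_right _ _ _ _ (by simp; omega),
    List.getD_append_right _ _ _ _ (by simp; omega),
    List.getD_append_right _ _ _ _ (by simp; omega), List.getD_append _ _ _ _ (by simp; omega)]
  simp [List.getD_eq_getElem?_getD, Nat.add_assoc]

theorem mem_face {s : State} (hs : M.IsLoaded s) (d : Fin M.numDarts) :
    s.mem (s.reg 7 + d) = M.face d := by
  have := d.2
  rw [hs.face, hs.input _ (by rw [length_encode]; omega)]
  simp only [encode, List.append_assoc]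
  rw [List.getD_append_right _ _ _ _ (by simp; omega),
    List.getD_append_right _ _ _ _ (by simp; omega),
    List.getD_append_right _ _ _ _ (by simp; omega),
    List.getD_append_right _ _ _ _ (by simp; omega), List.getD_append _ _ _ _ (by simp; omega)]
  simp [List.getD_eq_getElem?_getD, Nat.add_assoc]

end IsLoaded

variable (M) in
/-- The list of darts in memory, up to `e`, is the exploration `l`. -/
structure IsExploredTo (s : State) (l : List (Fin M.numDarts)) : Prop extends M.IsLoaded s where
  exploration : M.IsExploration l
  stores : Stores s.mem (s.reg 9) l

variable (M) in
/-- The invariant of the first loop. -/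
def ExploreInvariant (n : ℕ) (s : State) : Prop :=
  ∃ l, M.IsExploredTo s l ∧ s.reg 10 = s.reg 9 + l.length ∧
    (∀ g : Fin M.numFaces, s.mem (s.reg 8 + g) = 0 ↔ ¬ M.Reached l g) ∧ s.reg 11 ≤ M.numDarts ∧
    -- The darts from register `11` on have been scanned since the list last grew.
    (∀ e : Fin M.numDarts, s.reg 11 ≤ e → M.Reached l (M.face (M.twin e)) →
      M.Reached l (M.face e)) ∧
    -- Appending a dart resets register `11` to `numDarts`, less than the `numDarts + 1` lost in the
    -- product.
    n = (M.numDarts - l.length) * (M.numDarts + 1) + s.reg 11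

theorem exploreInvariant_setup :
    M.ExploreInvariant (M.numDarts * (M.numDarts + 1) + M.numDarts)
      (Program.setup.run (initialState M.encode)) := by
  have hL := M.length_encode
  have h0 : M.encode.getD 0 0 = M.numVertices := by simp [encode]
  have h1 : M.encode.getD 1 0 = M.numDarts := by simp [encode]
  have h2 : M.encode.getD 2 0 = M.numFaces := by simp [encode]
  have h3 : M.encode.getD 3 0 = M.outer := by simp [encode]
  have hreg : ∀ x, (initialState M.encode).reg x = 0 := fun _ => rfl
  have hmem : ∀ i, (initialState M.encode).mem i = M.encode.getD i 0 := fun _ => rfl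
  generalize initialState M.encode = s₀ at hreg hmem
  have hrun : ((Program.setup.run s₀).reg 11 = M.numDarts ∧
      (Program.setup.run s₀).reg 10 = (Program.setup.run s₀).reg 9) ∧
      M.IsLoaded (Program.setup.run s₀) ∧ ∀ i, (Program.setup.run s₀).mem i =
        if i = M.encode.length + M.outer then 1 else M.encode.getD i 0 := by
    generalize hs : Program.setup.run s₀ = s
    simp [Program.setup, Program.run, -List.getD_eq_getElem?_getD, h0, h1, h2, h3, hreg, hmem] at hs
    have hm (i) : s.mem i = if i = M.encode.length + M.outer then 1 else M.encode.getD i 0 := by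
      rw [← hs, hL]
      simp [-List.getD_eq_getElem?_getD, hmem]
    refine ⟨by simp [← hs], ⟨?_, ?_, ?_, ?_, ?_, ?_, ?_, ?_, ?_, ?_, fun i hi => ?_⟩, hm⟩
    case refine_11 => rw [hm, if_neg (by omega)]
    all_goals simp [← hs, hL]
  obtain ⟨⟨h11, h10⟩, hs, hm⟩ := hrun
  refine ⟨[], ⟨hs, .nil, trivial⟩, h10, fun g => ?_, h11.le, fun e he => ?_, ?_⟩
  -- Cells past the input hold the default `0`, so only the outer face is marked.
  · rw [hs.output, hm]
    simp [Reached, Fin.ext_iff]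
  · have := e.2
    omega
  · rw [h11, List.length_nil, Nat.sub_zero]

theorem ExploreInvariant.step {n : ℕ} {s : State} (h : M.ExploreInvariant n s)
    (h11 : s.reg 11 ≠ 0) : ∃ m < n, M.ExploreInvariant m (Program.explore.run s) := by
  obtain ⟨l, hl, h10, hmark, hle, hclosed, rfl⟩ := h
  have hs := hl.toIsLoaded
  -- The counter is decremented before use, so the dart examined is one below it.
  obtain ⟨d, hd⟩ : ∃ d : Fin M.numDarts, s.reg 11 = d + 1 :=
    ⟨⟨s.reg 11 - 1, by omega⟩, by simp only; omega⟩
  have hreg {x : ℕ} (hx : x < 10) := Program.fixes_explore.run_reg s hx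
  by_cases hnew : ¬ M.Reached l (M.face d) ∧ M.Reached l (M.face (M.twin d))
  · obtain ⟨hf, ht⟩ := hnew
    have hf' := (hmark _).2 hf
    have ht' := mt (hmark _).1 (not_not.2 ht)
    have r10 : (Program.explore.run s).reg 10 = s.reg 10 + 1 := by
      simp [Program.explore, Program.run, hd, hs.one, hs.mem_face, hs.mem_twin, hf', ht']
    have r11 : (Program.explore.run s).reg 11 = M.numDarts := by
      simp [Program.explore, Program.run, hd, hs.one, hs.mem_face, hs.mem_twin, hs.numDarts,
        hs.zero, hf', ht']
    have hm (i) : (Program.explore.run s).mem i =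
        if i = s.reg 9 + l.length then (d : ℕ) else if i = s.reg 8 + M.face d then 1
        else s.mem i := by
      simp [Program.explore, Program.run, hd, hs.one, hs.mem_face, hs.mem_twin, hf', ht', h10]
    have hexp : M.IsExploration (d :: l) := .cons hl.exploration hf ht
    have hlen := hexp.length_le
    rw [List.length_cons] at hlen
    refine ⟨(M.numDarts - (l.length + 1)) * (M.numDarts + 1) + M.numDarts, ?_, d :: l,
      ⟨hs.congr (fun x hx => hreg hx) fun i hi => ?_, hexp, ?_, ?_⟩, ?_, fun g => ?_, r11.le,
      fun e he => ?_, ?_⟩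
    · obtain ⟨k, hk⟩ := Nat.exists_eq_add_of_le hlen
      rw [show M.numDarts - (l.length + 1) = k by omega,
        show M.numDarts - l.length = k + 1 by omega, hd]
      nlinarith
    · rw [hm, hs.darts, hs.output, if_neg (by omega), if_neg (by omega)]
    · rw [hreg (by norm_num), hm, if_pos rfl]
    · rw [hreg (by norm_num)]
      refine hl.stores.congr fun i hi => ?_
      rw [hm, hs.darts, hs.output, if_neg (by omega), if_neg (by have := (M.face d).2; omega)]
    · rw [hreg (x := 9) (by norm_num), r10, h10, List.length_cons, add_assoc]
    · rw [hreg (by norm_num), hm, hs.darts, if_neg (by rw [hs.output]; have := g.2; omega),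
        reached_cons]
      by_cases hg : g = M.face d
      · simp [hg]
      · rw [if_neg (by simpa [Fin.ext_iff] using hg), hmark]
        simp [hg]
    -- After the reset, no dart counts as scanned.
    · have := e.2
      rw [r11] at he
      omega
    · rw [r11, List.length_cons]
  · have key : (Program.explore.run s).reg 10 = s.reg 10 ∧ (Program.explore.run s).reg 11 = d ∧
        (Program.explore.run s).mem = s.mem := by
      by_cases hf : M.Reached l (M.face d)
      · have hf' := mt (hmark _).1 (not_not.2 hf)
        simp [Program.explore, Program.run, hd, hs.one, hs.mem_face, hf']
      · have hf' := (hmark _).2 hf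
        have ht' := (hmark _).2 fun ht => hnew ⟨hf, ht⟩
        simp [Program.explore, Program.run, hd, hs.one, hs.mem_face, hs.mem_twin, hf', ht']
    obtain ⟨r10, r11, hm⟩ := key
    refine ⟨(M.numDarts - l.length) * (M.numDarts + 1) + d, by omega, l,
      ⟨hs.congr (fun x hx => hreg hx) fun i hi => by rw [hm], hl.exploration, ?_⟩, ?_,
      fun g => ?_, ?_, fun e he ht => ?_, ?_⟩
    · rw [hm, hreg (by norm_num)]
      exact hl.stores
    · rw [hreg (x := 9) (by norm_num), r10, h10]
    · rw [hm, hreg (by norm_num), hmark]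
    · omega
    · rw [r11] at he
      -- The only newly scanned dart is `d`, and it did not lead to a new face.
      rcases eq_or_lt_of_le he with h | h
      · obtain rfl : d = e := Fin.ext h
        by_contra hf
        exact hnew ⟨hf, ht⟩
      · exact hclosed e (by omega) ht
    · rw [r11]

/-- At the end of the first loop, all faces have been reached. -/
theorem ExploreInvariant.exists_isExploredTo (hM : M.IsPlane) {n : ℕ} {s : State}
    (h : M.ExploreInvariant n s) (h11 : s.reg 11 = 0) :
    ∃ l, M.IsExploredTo s l ∧ s.reg 10 = s.reg 9 + l.length ∧ ∀ g, M.Reached l g := by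
  obtain ⟨l, hl, h10, -, -, hclosed, -⟩ := h
  exact ⟨l, hl, h10, hM.forall_of_closed (Or.inl rfl) fun d => hclosed d (by omega)⟩

variable (M) in
/-- The invariant of the second loop. -/
def AssignInvariant (n : ℕ) (s : State) : Prop :=
  ∃ l, M.IsExploredTo s l ∧ s.reg 15 = l.length ∧
    -- The values overwrite the marks of the first loop. Marks that remain belong to faces in
    -- `Reached l`, about which nothing is claimed.
    M.IsAssignmentOutside l (fun g => s.mem (s.reg 8 + g)) ∧ n = l.length

theorem AssignInvariant.step (hT : M.InnerTriangulated) {n : ℕ} {s : State}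
    (h : M.AssignInvariant n s) (h15 : s.reg 15 ≠ 0) :
    ∃ m < n, M.AssignInvariant m (Program.assign.run s) := by
  obtain ⟨l, hl, hlen, hc, rfl⟩ := h
  obtain _ | ⟨d, l⟩ := l
  · exact absurd hlen h15
  have hs := hl.toIsLoaded
  rw [List.length_cons] at hlen
  have hd := hl.stores.1
  obtain ⟨s₁, hs₁⟩ : ∃ s₁, s₁ = Program.inspect.run s := ⟨_, rfl⟩
  have inspect : s₁.mem = s.mem ∧ s₁.reg 11 = d ∧ s₁.reg 15 = l.length ∧
      s₁.reg 14 = s.mem (s.reg 8 + M.face (M.twin (M.next d))) ∧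
      s₁.reg 16 = s.mem (s.reg 8 + M.face (M.twin (M.next (M.next d)))) ∧
      s₁.reg 17 = M.origin d ∧ s₁.reg 18 = M.origin (M.next d) ∧
      s₁.reg 19 = M.origin (M.next (M.next d)) := by
    subst hs₁
    simp [Program.inspect, Program.run, hlen, hs.one, hd, hs.mem_next, hs.mem_twin, hs.mem_face,
      hs.mem_origin]
  obtain ⟨m₁, e11, e15, e14, e16, e17, e18, e19⟩ := inspect
  have hreg₁ {x : ℕ} (hx : x < 10) : s₁.reg x = s.reg x :=
    hs₁ ▸ Program.fixes_inspect.run_reg s hx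
  obtain ⟨hd3, -, -⟩ := hl.exploration.isTriangle hT |>.darts rfl
  have n1 := origin_next_ne d
  have n2 := origin_next_ne (M.next d)
  have n3 := origin_next_ne (M.next (M.next d))
  rw [hd3] at n3
  obtain ⟨s₂, hs₂⟩ : ∃ s₂, s₂ = Program.choose.run s₁ := ⟨_, rfl⟩
  -- Registers `14` and `16` may hold leftover marks instead of vertices; avoiding these too does no
  -- harm.
  have choose := Program.run_choose_reg s₁ (by rw [hreg₁ (by norm_num), hs.zero])
    (by rw [e17, e18]; exact fun h => n1 (Fin.ext h.symm))
    (by rw [e17, e19]; exact fun h => n3 (Fin.ext h))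
    (by rw [e18, e19]; exact fun h => n2 (Fin.ext h.symm))
  rw [e14, e16, e17, e18, e19, ← hs₂] at choose
  obtain ⟨c1, c2, c3⟩ := choose
  have m₂ : s₂.mem = s.mem := by rw [hs₂, Program.run_choose_mem, m₁]
  have hreg₂ {x : ℕ} (hx : x < 20) : s₂.reg x = s₁.reg x :=
    hs₂ ▸ Program.fixes_choose.run_reg s₁ hx
  obtain ⟨v, hv, hvi⟩ : ∃ v : Fin M.numVertices, s₂.reg 22 = v ∧ M.Incident v (M.face d) := by
    rcases c3 with h | h | h
    · exact ⟨_, h, Or.inr ⟨_, rfl, rfl⟩⟩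
    · exact ⟨_, h, Or.inr ⟨_, rfl, M.face_next d⟩⟩
    · exact ⟨_, h, Or.inr ⟨_, rfl, by rw [M.face_next, M.face_next]⟩⟩
  rw [hv] at c1 c2
  have hr7 : s₂.mem (s₂.reg 7 + s₂.reg 11) = M.face d := by
    rw [m₂, hreg₂ (by norm_num), hreg₁ (by norm_num), hreg₂ (by norm_num), e11, hs.mem_face]
  have hr8 : s₂.reg 8 = s.reg 8 := by rw [hreg₂ (by norm_num), hreg₁ (by norm_num)]
  have hm (i) : (Program.assign.run s).mem i =
      if i = s.reg 8 + M.face d then (v : ℕ) else s.mem i := by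
    simp [Program.assign, Program.run, ← hs₁, ← hs₂, hr7, hr8, hv, m₂]
  have hreg {x : ℕ} (hx : x < 10) := Program.fixes_assign.run_reg s hx
  have hface := (M.face d).2
  refine ⟨l.length, by simp, l, ⟨hs.congr (fun x hx => hreg hx) fun i hi => ?_, ?_, ?_⟩, ?_, ?_,
    rfl⟩
  · rw [hm, hs.output, if_neg (by omega)]
  · cases hl.exploration with
    | cons h _ _ => exact h
  · rw [hreg (by norm_num)]
    refine hl.stores.2.congr fun i hi => ?_
    rw [hm, hs.darts, hs.output, if_neg (by omega)]
  · simp [Program.assign, Program.run, ← hs₁, ← hs₂, hreg₂, e15]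
  · convert hc.uncons hT hl.exploration hvi c1 c2 using 1
    funext g
    simp only [hreg (show 8 < 10 by norm_num), hm, Function.update_apply, Nat.add_left_cancel_iff,
      Fin.ext_iff]

/-- On a plane graph with triangulated inner faces, the algorithm finds in quadratically many
steps an assignment of the inner faces that is an EFXr orientation for all valuations. -/
theorem exists_exec_orient (hM : M.IsPlane) (hT : M.InnerTriangulated) :
    ∃ (t : ℕ) (s : State) (π : M.InnerFace → Fin M.numVertices),
      Exec Program.orient (initialState M.encode) t s ∧
      t ≤ Program.setup.size +
        (((M.numDarts * (M.numDarts + 1) + M.numDarts) * (Program.explore.size + 1) + 1) +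
          (1 + ((M.numDarts * (Program.assign.size + 1) + 1) + 2))) ∧
      (∀ g : Fin M.numFaces, s.mem (M.encode.length + g) =
        if h : g = M.outer then 0 else (π ⟨g, h⟩ : ℕ)) ∧
      ∀ V : Fin M.numVertices → Finset M.InnerFace → ℝ, M.IsFaceInstance V →
        FairDivision.IsOrientation V π ∧ FairDivision.IsEFXr V π := by
  obtain ⟨t₀, ht₀, he₀⟩ := Program.loopFree_setup.exists_exec (initialState M.encode)
  obtain ⟨t₁, ht₁, s₁, n₁, he₁, hI₁, hx₁⟩ := Program.loopFree_explore.exists_exec_while 11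
    (fun n s => ExploreInvariant.step) _ _ M.exploreInvariant_setup
  obtain ⟨l, hl, h10, hreach⟩ := hI₁.exists_isExploredTo hM hx₁
  obtain ⟨s₂, hs₂⟩ : ∃ s₂, s₂ = s₁.setReg 15 (s₁.reg 10 - s₁.reg 9) := ⟨_, rfl⟩
  have he₂ : Exec (.sub 15 10 9) s₁ 1 s₂ := hs₂ ▸ .sub ..
  have hreg₂ {x : ℕ} (hx : x < 10) : s₂.reg x = s₁.reg x := by
    rw [hs₂, State.setReg_reg, if_neg (by omega)]
  have hI₂ : M.AssignInvariant l.length s₂ := by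
    -- All faces are reached, so the conditions on the assignment hold vacuously at the start.
    refine ⟨l, ⟨hl.toIsLoaded.congr (fun x hx => hreg₂ hx) fun i hi => by rw [hs₂]; rfl,
      hl.exploration, ?_⟩, ?_, ⟨fun g hg => absurd (hreach g) hg, fun d hd =>
        absurd (hreach _) hd⟩, rfl⟩
    · rw [hreg₂ (by norm_num), hs₂]
      exact hl.stores
    · rw [hs₂, State.setReg_reg, if_pos rfl, h10, Nat.add_sub_cancel_left]
  obtain ⟨t₃, ht₃, s₃, n₃, he₃, ⟨l', hl', hlen, hc, -⟩, hx₃⟩ :=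
    Program.loopFree_assign.exists_exec_while 15 (fun n s => AssignInvariant.step hT) _ _ hI₂
  obtain rfl : l' = [] := List.eq_nil_of_length_eq_zero (hlen.symm.trans hx₃)
  have hs := hl'.toIsLoaded
  obtain ⟨π, hπ, hV⟩ := hc.exists_orientation hT
  have ht : t₃ ≤ M.numDarts * (Program.assign.size + 1) + 1 :=
    ht₃.trans (Nat.succ_le_succ (Nat.mul_le_mul_right _ hl.exploration.length_le))
  -- The final store replaces the mark of the outer face by the `0` that the output format requires.
  refine ⟨_, _, π, he₀.seq (he₁.seq (he₂.seq (he₃.seq ((Exec.add 12 8 3 s₃).seq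
    (.store 12 2 _))))), by omega, fun g => ?_, hV⟩
  simp only [State.setMem_mem, State.setReg_reg, State.setReg_mem, if_true, Nat.reduceEqDiff,
    if_false, hs.output, hs.outer, hs.zero, Nat.add_left_cancel_iff, ← Fin.ext_iff]
  split_ifs with h
  · rfl
  · rw [← hπ ⟨g, h⟩, hs.output]

theorem solvableInPolyTime : SolvableInPolyTime encode
    (fun M => M.IsPlane ∧ M.InnerTriangulated)
    (fun M output => ∃ π : M.InnerFace → Fin M.numVertices,
      output = M.encodeAllocation π ∧
      ∀ V : Fin M.numVertices → Finset M.InnerFace → ℝ, M.IsFaceInstance V →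
        FairDivision.IsOrientation V π ∧ FairDivision.IsEFXr V π) := by
  open Polynomial in
  -- This is the step bound of `exists_exec_orient` with `numDarts` replaced by the input length,
  -- which is at least as large.
  refine ⟨Program.orient, C Program.setup.size +
        (((X * (X + 1) + X) * C (Program.explore.size + 1) + 1) +
          (1 + ((X * C (Program.assign.size + 1) + 1) + 2))), fun M hM => ?_⟩
  obtain ⟨t, s, π, he, ht, hs, hV⟩ := exists_exec_orient hM.1 hM.2
  refine ⟨t, s, M.encodeAllocation π, he, ht.trans ?_, fun i hi => ?_, π, rfl, hV⟩
  · have : M.numDarts ≤ M.encode.length := by rw [length_encode]; omega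
    simp only [Polynomial.eval_add, Polynomial.eval_mul, Polynomial.eval_C, Polynomial.eval_X,
      Polynomial.eval_one, Polynomial.eval_ofNat]
    gcongr
  · simp only [encodeAllocation, List.length_ofFn] at hi
    simpa [encodeAllocation] using hs ⟨i, hi⟩

end EmbeddedGraph

/-- Every instance given by a plane graph with triangulated inner faces has an EFXr orientation;
and one polynomial-time algorithm, which needs only the embedded graph and no queries to the
valuations, finds an allocation that is an EFXr orientation for all such valuations. -/
theorem mainTheorem9 :
    (∀ M : EmbeddedGraph, M.IsPlane → M.InnerTriangulated →
      ∀ V : Fin M.numVertices → Finset M.InnerFace → ℝ, M.IsFaceInstance V →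
        ∃ π : M.InnerFace → Fin M.numVertices,
          FairDivision.IsOrientation V π ∧ FairDivision.IsEFXr V π) ∧
    RAM.SolvableInPolyTime EmbeddedGraph.encode
      (fun M => M.IsPlane ∧ M.InnerTriangulated)
      (fun M output => ∃ π : M.InnerFace → Fin M.numVertices,
        output = M.encodeAllocation π ∧
        ∀ V : Fin M.numVertices → Finset M.InnerFace → ℝ, M.IsFaceInstance V →
          FairDivision.IsOrientation V π ∧ FairDivision.IsEFXr V π) := by
  refine ⟨fun M hM hT V hV => ?_, EmbeddedGraph.solvableInPolyTime⟩
  obtain ⟨-, -, π, -, -, -, h⟩ := EmbeddedGraph.exists_exec_orient hM hT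
  exact ⟨π, h V hV⟩
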